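/- Let $\mathbf{M}$ be a complete and cocomplete closed symmetric monoidal category which is additive. Let $\overline{\mathbf{C}}=(\mathbf{C},\perp)$ be an orthogonal category, i.e. a small category $\mathbf{C}$ with a symmetric relation $f_1\perp f_2$ on pairs of morphisms with common target such that $f_1\perp f_2$ implies $g f_1 h_1\perp g f_2 h_2$ for all composable $g,h_1,h_2$. A unital Lie algebra in $\mathbf{M}$ is an object $V$ with a bracket $[\cdot,\cdot]:V\otimes V\to V$ that is antisymmetric and satisfies the Jacobi identity, and a unit $\eta:I\to V$ with $[\cdot,\eta]=0$. Let $\mathbf{LFT}(\overline{\mathbf{C}})$ (linear field theories) be the full subcategory of the category of functors $\mathfrak{L}$ from $\mathbf{C}$ to unital Lie algebras in $\mathbf{M}$ on those with $[\cdot,\cdot]_c\,(\mathfrak{L}(f_1)\otimes\mathfrak{L}(f_2))=0$ for all $(f_1:c_1\to c)\perp(f_2:c_2\to c)$. Let $\mathbf{QFT}(\overline{\mathbf{C}})$ (quantum field theories) be the full subcategory of the category of functors $\mathfrak{A}$ from $\mathbf{C}$ to associative unital algebras in $\mathbf{M}$ on those with $(\mu_c-\mu_c^{\mathrm{op}})\,(\mathfrak{A}(f_1)\otimes\mathfrak{A}(f_2))=0$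 for all such $f_1\perp f_2$. Let $\mathfrak{U}_{\mathrm{lin}}:\mathbf{QFT}(\overline{\mathbf{C}})\to\mathbf{LFT}(\overline{\mathbf{C}})$ be the functor that applies $(A,\mu,\eta)\mapsto(A,\mu-\mu^{\mathrm{op}},\eta)$ objectwise. For a full subcategory $j:\mathbf{B}\to\mathbf{C}$ with the restricted orthogonality relation (a full orthogonal subcategory $j:\overline{\mathbf{B}}\to\overline{\mathbf{C}}$), let $j^*$ denote restriction of (linear, or quantum) field theories from $\overline{\mathbf{C}}$ to $\overline{\mathbf{B}}$, and $j_!$ its left adjoint. A field theory $\mathfrak{A}$ on $\overline{\mathbf{C}}$ is $j$-local (descent) if the counit $j_!\,j^*\mathfrak{A}\to\mathfrak{A}$ is an isomorphism. For a set $W$ of morphisms of $\mathbf{C}$, a field theory $\mathfrak{A}$ is $W$-constant (time-slice axiom) if $\mathfrak{A}(f)$ is an isomorphism for every $f\in W$. Then $\mathfrak{U}_{\mathrm{lin}}$ has a left adjoint, the linear quantization functor $\mathfrak{Q}_{\mathrm{lin}}:\mathbf{LFT}(\overline{\mathbf{C}})\to\mathbf{QFT}(\overline{\mathbf{C}})$,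 and (a) for every full orthogonal subcategory $j:\overline{\mathbf{B}}\to\overline{\mathbf{C}}$, $\mathfrak{Q}_{\mathrm{lin}}$ maps $j$-local linear field theories to $j$-local quantum field theories; (b) for every set $W$ of morphisms of $\mathbf{C}$, $\mathfrak{Q}_{\mathrm{lin}}$ maps $W$-constant linear field theories to $W$-constant quantum field theories. -/

import Mathlib

universe v u

open CategoryTheory MonoidalCategory Limits

namespace FieldTheory

/-! ### Orthogonal categories -/

section Orthogonal

/-- An orthogonality relation on a category: a symmetric relation on pairs of morphisms with a
common target which is stable under post- and precomposition. A category together with such a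
relation is an orthogonal category. -/
structure OrthogonalityRelation (C : Type v) [SmallCategory C] where
  /-- `Rel f₁ f₂` is the relation `f₁ ⊥ f₂`. -/
  Rel : ∀ ⦃c₁ c₂ c : C⦄, (c₁ ⟶ c) → (c₂ ⟶ c) → Prop
  symm : ∀ ⦃c₁ c₂ c : C⦄ (f₁ : c₁ ⟶ c) (f₂ : c₂ ⟶ c), Rel f₁ f₂ → Rel f₂ f₁
  comp : ∀ ⦃b₁ b₂ c₁ c₂ c d : C⦄ (g : c ⟶ d) (f₁ : c₁ ⟶ c) (f₂ : c₂ ⟶ c)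
    (h₁ : b₁ ⟶ c₁) (h₂ : b₂ ⟶ c₂), Rel f₁ f₂ → Rel (h₁ ≫ f₁ ≫ g) (h₂ ≫ f₂ ≫ g)

/-- The pullback orthogonality relation on a full subcategory. The category `P.FullSubcategory`
with this relation, and the inclusion `j = P.ι`, form a full orthogonal subcategory. -/
def OrthogonalityRelation.restrict {D : Type v} [SmallCategory D] (perp : OrthogonalityRelation D)
    (P : ObjectProperty D) : OrthogonalityRelation P.FullSubcategory where
  Rel _ _ _ f₁ f₂ := perp.Rel (P.ι.map f₁) (P.ι.map f₂)
  symm _ _ _ _ _ h := perp.symm _ _ h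
  comp _ _ _ _ _ _ g f₁ f₂ h₁ h₂ h := by
    simpa only [Functor.map_comp] using
      perp.comp (P.ι.map g) (P.ι.map f₁) (P.ι.map f₂) (P.ι.map h₁) (P.ι.map h₂) h

end Orthogonal

/-! ### Unital Lie algebras and the commutator functor -/

/-- In a closed symmetric monoidal additive category the monoidal product of morphisms is
biadditive, because the functors `X ⊗ -` preserve finite coproducts. -/
instance monoidalPreadditive (M : Type u) [Category.{v} M] [MonoidalCategory M]
    [SymmetricCategory M] [MonoidalClosed M] [Preadditive M] [HasFiniteCoproducts M] :
    MonoidalPreadditive M := by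
  have : HasFiniteBiproducts M := HasFiniteBiproducts.of_hasFiniteCoproducts
  have hadd (X : M) : (tensorLeft X).Additive := by
    have : PreservesColimitsOfSize.{0, 0} (tensorLeft X) :=
      (Closed.adj (X := X)).leftAdjoint_preservesColimits
    have : HasBinaryBiproducts M := hasBinaryBiproducts_of_finite_biproducts M
    have := preservesBinaryBiproducts_of_preservesBinaryCoproducts (tensorLeft X)
    exact Functor.additive_of_preservesBinaryBiproducts _
  have h0 (X : M) {Y Z : M} : X ◁ (0 : Y ⟶ Z) = 0 := (tensorLeft X).map_zero Y Z
  have h1 (X : M) {Y Z : M} (f g : Y ⟶ Z) : X ◁ (f + g) = X ◁ f + X ◁ g :=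
    (tensorLeft X).map_add
  have hr (X : M) {Y Z : M} (f : Y ⟶ Z) : f ▷ X = (β_ Y X).hom ≫ X ◁ f ≫ (β_ X Z).hom := by
    simp
  exact
    { whiskerLeft_zero := h0 _
      whiskerLeft_add := h1 _
      zero_whiskerRight := by intro X Y Z; rw [hr, h0]; simp
      add_whiskerRight := by intro X Y Z f g; rw [hr, hr, hr, h1]; simp }

section Lie

variable {M : Type u} [Category.{v} M] [MonoidalCategory M] [SymmetricCategory M]

/-- The cyclic permutation `x ⊗ (y ⊗ z) ↦ y ⊗ (z ⊗ x)`. -/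
def cyc (X : M) : X ⊗ (X ⊗ X) ⟶ X ⊗ (X ⊗ X) :=
  (β_ X (X ⊗ X)).hom ≫ (α_ X X X).hom

lemma cyc_cyc (X : M) : cyc X ≫ cyc X = X ◁ (β_ X X).hom ≫ (α_ X X X).inv ≫
    (β_ X X).hom ▷ X ≫ (α_ X X X).hom := by
  have h := BraidedCategory.yang_baxter X X X =≫ (X ◁ (β_ X X).hom)
  simp only [Category.assoc, ← MonoidalCategory.whiskerLeft_comp, SymmetricCategory.symmetry,
    MonoidalCategory.whiskerLeft_id, Category.comp_id] at h
  simpa [cyc, BraidedCategory.braiding_tensor_right_hom] using h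

lemma cyc_cyc_cyc (X : M) : cyc X ≫ cyc X ≫ cyc X = 𝟙 _ := by
  rw [← Category.assoc, cyc_cyc]
  simp only [cyc, BraidedCategory.braiding_tensor_right_hom, Category.assoc,
    Iso.hom_inv_id_assoc, Iso.inv_hom_id, Category.comp_id]
  rw [← comp_whiskerRight_assoc]
  simp [← MonoidalCategory.whiskerLeft_comp]

lemma whiskerLeft_braiding_cyc (X : M) :
    X ◁ (β_ X X).hom ≫ cyc X = cyc X ≫ cyc X ≫ X ◁ (β_ X X).hom := by
  rw [← Category.assoc (cyc X), cyc_cyc]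
  simp [cyc, BraidedCategory.braiding_tensor_right_hom]

variable (M) [Preadditive M]

/-- Unital Lie algebras in `M`: the algebras over the unital Lie operad, which is presented by a
binary bracket and a nullary unit `η`, with antisymmetry, the Jacobi identity
`[x, [y, z]] + [y, [z, x]] + [z, [x, y]] = 0`, and `[x, η] = 0`. -/
structure ULie where
  /-- the underlying object -/
  X : M
  /-- the Lie bracket -/
  bracket : X ⊗ X ⟶ X
  /-- the unit -/
  unit : 𝟙_ M ⟶ X
  antisymm : (β_ X X).hom ≫ bracket = -bracket
  jacobi : X ◁ bracket ≫ bracket + cyc X ≫ X ◁ bracket ≫ bracket +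
    cyc X ≫ cyc X ≫ X ◁ bracket ≫ bracket = 0
  bracket_unit : X ◁ unit ≫ bracket = 0

variable {M}

namespace ULie

/-- Morphisms of unital Lie algebras preserve the bracket and the unit. -/
@[ext]
structure Hom (V W : ULie M) where
  /-- the underlying morphism -/
  hom : V.X ⟶ W.X
  bracket_hom : V.bracket ≫ hom = (hom ⊗ₘ hom) ≫ W.bracket
  unit_hom : V.unit ≫ hom = W.unit

instance : Category (ULie M) where
  Hom V W := Hom V W
  id V := ⟨𝟙 V.X, by simp, by simp⟩
  comp f g := ⟨f.hom ≫ g.hom,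
    by rw [← Category.assoc, f.bracket_hom, Category.assoc, g.bracket_hom,
      ← Category.assoc, tensorHom_comp_tensorHom],
    by rw [← Category.assoc, f.unit_hom, g.unit_hom]⟩
  id_comp f := Hom.ext (Category.id_comp f.hom)
  comp_id f := Hom.ext (Category.comp_id f.hom)
  assoc f g h := Hom.ext (Category.assoc f.hom g.hom h.hom)

end ULie

/-- The commutator `μ - μᵒᵖ` of an associative and unital algebra (monoid object). -/
def commutator (A : Mon M) : A.X ⊗ A.X ⟶ A.X :=
  MonObj.mul - (β_ A.X A.X).hom ≫ MonObj.mul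

lemma commutator_antisymm (A : Mon M) : (β_ A.X A.X).hom ≫ commutator A = -commutator A := by
  simp [commutator]

lemma commutator_hom {A B : Mon M} (f : A ⟶ B) :
    commutator A ≫ f.hom = (f.hom ⊗ₘ f.hom) ≫ commutator B := by
  simp [commutator]

lemma commutator_jacobi [MonoidalPreadditive M] (A : Mon M) :
    A.X ◁ commutator A ≫ commutator A + cyc A.X ≫ A.X ◁ commutator A ≫ commutator A +
      cyc A.X ≫ cyc A.X ≫ A.X ◁ commutator A ≫ commutator A = 0 := by
  set σ := cyc A.X with hσ
  set s := A.X ◁ (β_ A.X A.X).hom with hs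
  set m := A.X ◁ (MonObj.mul (X := A.X)) ≫ MonObj.mul with hm
  have e₁ : A.X ◁ (MonObj.mul (X := A.X)) ≫ (β_ A.X A.X).hom ≫ MonObj.mul = σ ≫ m := by
    simp [hσ, hm, cyc, MonObj.mul_assoc]
  have hsub (f g : A.X ⊗ A.X ⟶ A.X) : A.X ◁ (f - g) = A.X ◁ f - A.X ◁ g :=
    (tensorLeft A.X).map_sub
  have e : A.X ◁ commutator A ≫ commutator A = m - s ≫ m - σ ≫ m + s ≫ σ ≫ m := by
    simp only [commutator, hsub, MonoidalCategory.whiskerLeft_comp,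
      Preadditive.sub_comp, Preadditive.comp_sub, Category.assoc, e₁]
    abel
  have h₃ : σ ≫ σ ≫ σ ≫ m = m := by
    have := cyc_cyc_cyc A.X =≫ m
    simpa using this
  have h₂ : s ≫ σ ≫ m = σ ≫ σ ≫ s ≫ m := by
    have := whiskerLeft_braiding_cyc A.X =≫ m
    simpa using this
  have h₄ : σ ≫ σ ≫ σ ≫ s ≫ m = s ≫ m := by
    have := cyc_cyc_cyc A.X =≫ (s ≫ m)
    simpa using this
  rw [e]
  simp only [Preadditive.comp_add, Preadditive.comp_sub, h₂, h₃, h₄]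
  abel

lemma commutator_one (A : Mon M) : A.X ◁ MonObj.one ≫ commutator A = 0 := by
  simp [commutator]

variable (M) in
/-- The functor `φ^*` from associative and unital algebras to unital Lie algebras which sends
`(A, μ, η)` to `(A, μ - μᵒᵖ, η)`. It is the pullback along the operad morphism
`φ : uLie ⟶ As` with `[·,·] ↦ μ - μᵒᵖ` and `η ↦ η`. -/
def commutatorFunctor [MonoidalPreadditive M] : Mon M ⥤ ULie M where
  obj A := 
    { X := A.X
      bracket := commutator A
      unit := MonObj.one
      antisymm := commutator_antisymm A
      jacobi := commutator_jacobi A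
      bracket_unit := commutator_one A }
  map f := ⟨f.hom, commutator_hom f, IsMonHom.one_hom f.hom⟩
  map_id _ := rfl
  map_comp _ _ := rfl

end Lie

/-! ### Linear and quantum field theories -/

section Theories

variable (M : Type u) [Category.{v} M] [MonoidalCategory M] [SymmetricCategory M] [Preadditive M]
variable {C D : Type v} [SmallCategory C] [SmallCategory D]

/-- The causality axiom for linear field theories: `[𝔏(f₁)(-), 𝔏(f₂)(-)] = 0` if `f₁ ⊥ f₂`. -/
def IsLFT (perp : OrthogonalityRelation C) : ObjectProperty (C ⥤ ULie M) := fun L =>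
  ∀ ⦃c₁ c₂ c : C⦄ (f₁ : c₁ ⟶ c) (f₂ : c₂ ⟶ c), perp.Rel f₁ f₂ →
    ((L.map f₁).hom ⊗ₘ (L.map f₂).hom) ≫ (L.obj c).bracket = 0

/-- The Einstein causality axiom: the commutator `[𝔄(f₁)(-), 𝔄(f₂)(-)]` vanishes if `f₁ ⊥ f₂`. -/
def IsQFT (perp : OrthogonalityRelation C) : ObjectProperty (C ⥤ Mon M) := fun A =>
  ∀ ⦃c₁ c₂ c : C⦄ (f₁ : c₁ ⟶ c) (f₂ : c₂ ⟶ c), perp.Rel f₁ f₂ →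
    ((A.map f₁).hom ⊗ₘ (A.map f₂).hom) ≫ commutator (A.obj c) = 0

/-- The category of linear field theories, a full subcategory of the category of functors from `C`
to unital Lie algebras. -/
abbrev LFT (perp : OrthogonalityRelation C) := (IsLFT M perp).FullSubcategory

/-- The category of quantum field theories, a full subcategory of the category of functors from
`C` to associative and unital algebras. -/
abbrev QFT (perp : OrthogonalityRelation C) := (IsQFT M perp).FullSubcategory

/-- The restriction functor `j^*` on linear field theories, for the full orthogonal subcategory
`j = P.ι`. -/
def LFT.restrict (perp : OrthogonalityRelation D) (P : ObjectProperty D) :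
    LFT M perp ⥤ LFT M (perp.restrict P) :=
  (IsLFT M (perp.restrict P)).lift
    ((IsLFT M perp).ι ⋙ (Functor.whiskeringLeft _ _ (ULie M)).obj P.ι)
    (fun L _ _ _ f₁ f₂ h => L.property (P.ι.map f₁) (P.ι.map f₂) h)

/-- The restriction functor `j^*` on quantum field theories, for the full orthogonal subcategory
`j = P.ι`. -/
def QFT.restrict (perp : OrthogonalityRelation D) (P : ObjectProperty D) :
    QFT M perp ⥤ QFT M (perp.restrict P) :=
  (IsQFT M (perp.restrict P)).lift
    ((IsQFT M perp).ι ⋙ (Functor.whiskeringLeft _ _ (Mon M)).obj P.ι)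
    (fun A _ _ _ f₁ f₂ h => A.property (P.ι.map f₁) (P.ι.map f₂) h)

/-- The functor `𝔘_lin = (φ^*)_*` from quantum to linear field theories, which applies the
commutator functor objectwise. The linear quantization functor is its left adjoint. -/
def Ulin [MonoidalPreadditive M] (perp : OrthogonalityRelation C) : QFT M perp ⥤ LFT M perp :=
  (IsLFT M perp).lift
    ((IsQFT M perp).ι ⋙ (Functor.whiskeringRight C _ _).obj (commutatorFunctor M))
    (fun A _ _ _ f₁ f₂ h => A.property f₁ f₂ h)

end Theories

/-! ### Locality and constancy -/

section Properties

universe v₁ v₂ u₁ u₂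

/-- For a functor `R` with left adjoint `L`, the property of an object `A` that the component
`L (R A) ⟶ A` of the counit is an isomorphism (see `isIsoCounit_iff` below). Here `L` is Mathlib's
partial left adjoint of `R`: its being defined at `R A` is part of the property, so that nothing
has to be assumed about `R`, and the counit is the morphism which corresponds to the identity of
`R A`. -/
def IsIsoCounit {𝒜 : Type u₁} [Category.{v₁} 𝒜] {ℬ : Type u₂} [Category.{v₂} ℬ] (R : 𝒜 ⥤ ℬ)
    (A : 𝒜) : Prop :=
  ∃ h : R.leftAdjointObjIsDefined (R.obj A),
    IsIso (R.partialLeftAdjointHomEquiv (X := ⟨R.obj A, h⟩) (Y := A)|>.symm (𝟙 (R.obj A)))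

/-- If `R` has a left adjoint then `IsIsoCounit R A` says that the component at `A` of the counit
of the adjunction is an isomorphism, for any choice of the left adjoint. -/
theorem isIsoCounit_iff {𝒜 : Type u₁} [Category.{v₁} 𝒜] {ℬ : Type u₂} [Category.{v₂} ℬ]
    {R : 𝒜 ⥤ ℬ} {L : ℬ ⥤ 𝒜} (adj : L ⊣ R) (A : 𝒜) :
    IsIsoCounit R A ↔ IsIso (adj.counit.app A) := by
  have key (h : R.leftAdjointObjIsDefined (R.obj A)) :
      ∃ e : L.obj (R.obj A) ≅ R.partialLeftAdjointObj ⟨R.obj A, h⟩,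
        e.hom ≫ R.partialLeftAdjointHomEquiv.symm (𝟙 (R.obj A)) = adj.counit.app A := by
    let X : R.PartialLeftAdjointSource := ⟨R.obj A, h⟩
    let u : R.obj A ⟶ R.obj (R.partialLeftAdjointObj X) :=
      R.partialLeftAdjointHomEquiv (X := X) (𝟙 _)
    have hu {Y : 𝒜} (g : R.partialLeftAdjointObj X ⟶ Y) :
        R.partialLeftAdjointHomEquiv g = u ≫ R.map g := by
      rw [← R.partialLeftAdjointHomEquiv_comp, Category.id_comp]
    refine ⟨⟨(adj.homEquiv _ _).symm u, (R.partialLeftAdjointHomEquiv (X := X)).symm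
      (adj.homEquiv _ _ (𝟙 _)), ?_, ?_⟩, ?_⟩
    · apply (adj.homEquiv _ _).injective
      rw [adj.homEquiv_naturality_right, Equiv.apply_symm_apply, ← hu, Equiv.apply_symm_apply]
    · apply (R.partialLeftAdjointHomEquiv (X := X)).injective
      rw [R.partialLeftAdjointHomEquiv_comp, Equiv.apply_symm_apply,
        ← adj.homEquiv_naturality_right, Category.id_comp, Equiv.apply_symm_apply]
    · apply (adj.homEquiv _ _).injective
      rw [adj.homEquiv_naturality_right, Equiv.apply_symm_apply, ← hu (Y := A),
        Equiv.apply_symm_apply]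
      simp [Adjunction.homEquiv_unit]
  constructor
  · rintro ⟨h, hi⟩
    obtain ⟨e, he⟩ := key h
    rw [← he]
    infer_instance
  · intro hi
    have h := Functor.leftAdjointObjIsDefined_of_adjunction adj (R.obj A)
    obtain ⟨e, he⟩ := key h
    refine ⟨h, ?_⟩
    rw [← he] at hi
    exact IsIso.of_isIso_comp_left e.hom _

variable {M : Type u} [Category.{v} M] [MonoidalCategory M] [SymmetricCategory M] [Preadditive M]
variable {C : Type v} [SmallCategory C] {perp : OrthogonalityRelation C}

/-- A linear field theory is `j`-local, for the full orthogonal subcategory `j = P.ι`, if the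
counit `j_! j^* L ⟶ L` is an isomorphism. -/
def LFT.IsJLocal (P : ObjectProperty C) (L : LFT M perp) : Prop :=
  IsIsoCounit (LFT.restrict M perp P) L

/-- A quantum field theory is `j`-local, for the full orthogonal subcategory `j = P.ι`, if the
counit `j_! j^* A ⟶ A` is an isomorphism. -/
def QFT.IsJLocal (P : ObjectProperty C) (A : QFT M perp) : Prop :=
  IsIsoCounit (QFT.restrict M perp P) A

/-- A linear field theory is `W`-constant if it maps every morphism in `W` to an isomorphism of
unital Lie algebras. -/
def LFT.IsWConstant (W : MorphismProperty C) (L : LFT M perp) : Prop :=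
  ∀ ⦃c c' : C⦄ (f : c ⟶ c'), W f → IsIso (L.obj.map f)

/-- A quantum field theory is `W`-constant if it maps every morphism in `W` to an isomorphism of
associative and unital algebras. -/
def QFT.IsWConstant (W : MorphismProperty C) (A : QFT M perp) : Prop :=
  ∀ ⦃c c' : C⦄ (f : c ⟶ c'), W f → IsIso (A.obj.map f)

end Properties

end FieldTheory

/-! Linear quantization is the universal enveloping algebra applied objectwise, with the unit of the
Lie algebra identified with the unit of the algebra. An enveloping algebra is generated by its Lie
algebra, and morphisms out of it commute as soon as they commute on generators (`Envelope.commute`).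
Causality of a linear field theory therefore gives Einstein causality of its quantization
(`isQFT_comp_envelope`), and the objectwise adjunction restricts to the full subcategories of field
theories.

Since `M` is only additive, the envelope is characterized by a universal property instead of
elements. The tensor algebra `T` of `V` makes `T ⊗ Y` the free object on `Y` with a map `V ⊗ Z ⟶ Z`.
Dividing `T` by the two-sided ideal of the bracket and unit relations gives `U` such that `U ⊗ Y` is
the free Lie module on `Y`. Only cocontinuity of the tensor product is used, which closedness and
symmetry supply. The product on `U`, its axioms, the extension of Lie morphisms to algebra morphisms
and the commutation lemma all follow from existence and uniqueness of equivariant maps.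

For locality, no `j_!` has to be constructed: the counit at `A` is an isomorphism exactly when
restriction is bijective on morphisms out of `A` (`isIsoCounit_iff_bijective_map`). Restriction
commutes with quantization, with `Ulin` and with transposition, because all are objectwise, so this
bijectivity passes from `L` to its quantization. Constancy holds because functors preserve
isomorphisms. -/

namespace FieldTheory

/-! ### Isomorphic counits in terms of morphism sets. -/

section Counit

universe v₁ v₂ u₁ u₂

variable {𝒜 : Type u₁} [Category.{v₁} 𝒜] {ℬ : Type u₂} [Category.{v₂} ℬ]

/-- The counit of the partial left adjoint of `R` is defined at `A` and an isomorphism if and only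
if `R` is bijective on morphisms out of `A`. -/
theorem isIsoCounit_iff_bijective_map (R : 𝒜 ⥤ ℬ) (A : 𝒜) :
    IsIsoCounit R A ↔
      ∀ A' : 𝒜, Function.Bijective (fun g : A ⟶ A' => R.map g) := by
  have key (h : R.leftAdjointObjIsDefined (R.obj A)) (A' : 𝒜) (g : A ⟶ A') :
      R.partialLeftAdjointHomEquiv (X := ⟨R.obj A, h⟩)
        (R.partialLeftAdjointHomEquiv.symm (𝟙 (R.obj A)) ≫ g) = R.map g := by
    rw [R.partialLeftAdjointHomEquiv_comp, Equiv.apply_symm_apply]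
    exact Category.id_comp _
  constructor
  · rintro ⟨h, hi⟩ A'
    have := (R.partialLeftAdjointHomEquiv (X := ⟨R.obj A, h⟩) (Y := A')).bijective.comp
      ((isIso_iff_coyoneda_map_bijective _).1 hi A')
    convert this using 2 with g
    exact (key h A' g).symm
  · intro hb
    -- The bijections `g ↦ R.map g` say that `A` itself corepresents the functor required of a left
    -- adjoint at `R.obj A`.
    have h : R.leftAdjointObjIsDefined (R.obj A) := by
      rw [Functor.leftAdjointObjIsDefined_iff]
      refine Functor.CorepresentableBy.isCorepresentable (X := A)
        { homEquiv := fun {A'} => Equiv.ofBijective _ (hb A')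
          homEquiv_comp := fun g f => R.map_comp f g }
    refine ⟨h, (isIso_iff_coyoneda_map_bijective _).2 fun A' => ?_⟩
    rw [← Function.Bijective.of_comp_iff'
      (R.partialLeftAdjointHomEquiv (X := ⟨R.obj A, h⟩) (Y := A')).bijective]
    convert hb A' using 2 with g
    exact key h A' g

lemma IsIsoCounit.of_iso {R : 𝒜 ⥤ ℬ} {A B : 𝒜} (e : A ≅ B) (h : IsIsoCounit R A) :
    IsIsoCounit R B := by
  rw [isIsoCounit_iff_bijective_map] at h ⊢
  intro A'
  have h₁ : Function.Bijective fun g : R.obj A ⟶ R.obj A' => R.map e.inv ≫ g :=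
    (R.mapIso e).homFromEquiv.bijective
  have h₂ : Function.Bijective fun g : B ⟶ A' => e.hom ≫ g := e.symm.homFromEquiv.bijective
  convert (h₁.comp (h A')).comp h₂ using 2 with g
  change R.map g = R.map e.inv ≫ R.map (e.hom ≫ g)
  rw [← R.map_comp, e.inv_hom_id_assoc]

end Counit

variable {M : Type u} [Category.{v} M] [MonoidalCategory M]
  [MonoidalClosed M] [HasColimits M]

/-! ### Free objects for an action -/

section FreeAction

variable (V : M)

/-- The tensor power `V ⊗ (V ⊗ ⋯ ⊗ 𝟙_ M)`. -/
def tensorPower : ℕ → M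
  | 0 => 𝟙_ M
  | n + 1 => V ⊗ tensorPower n

/-- The underlying object of the tensor algebra. -/
noncomputable def tensorAlg : M := ∐ tensorPower V

namespace tensorAlg

/-- The inclusion of a tensor power in the tensor algebra. -/
noncomputable def incl (n : ℕ) : tensorPower V n ⟶ tensorAlg V := Sigma.ι (tensorPower V) n

/-- The unit of the tensor algebra. -/
noncomputable def one : 𝟙_ M ⟶ tensorAlg V := incl V 0

/-- The inclusion of `V ⊗ V^n` in the tensor algebra. -/
noncomputable def consIncl (n : ℕ) : V ⊗ tensorPower V n ⟶ tensorAlg V := incl V (n + 1)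

lemma exists_act : ∃ a : V ⊗ tensorAlg V ⟶ tensorAlg V,
    ∀ n, V ◁ incl V n ≫ a = consIncl V n := by
  let hc := isColimitOfPreserves (tensorLeft V) (coproductIsCoproduct (tensorPower V))
  exact ⟨hc.desc ⟨_, Discrete.natTrans fun ⟨n⟩ => consIncl V n⟩, fun n => hc.fac _ ⟨n⟩⟩

/-- The action of `V` on the tensor algebra by left multiplication. -/
noncomputable def act : V ⊗ tensorAlg V ⟶ tensorAlg V := (exists_act V).choose

lemma incl_act (n : ℕ) : V ◁ incl V n ≫ act V = consIncl V n := (exists_act V).choose_spec n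

variable {V}
variable {Y Z : M}

/-- The restriction of `desc` to a tensor power. -/
def powerDesc (y : Y ⟶ Z) (a : V ⊗ Z ⟶ Z) : ∀ n, tensorPower V n ⊗ Y ⟶ Z
  | 0 => (λ_ Y).hom ≫ y
  | n + 1 => (α_ V (tensorPower V n) Y).hom ≫ V ◁ powerDesc y a n ≫ a

variable [SymmetricCategory M]

/-- Closedness makes `V ⊗ -` cocontinuous; the symmetry carries this over to `- ⊗ Y`, so `tensorAlg
V ⊗ Y` is again a coproduct. -/
lemma whiskerRight_hom_ext {f g : tensorAlg V ⊗ Y ⟶ Z}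
    (h : ∀ n, incl V n ▷ Y ≫ f = incl V n ▷ Y ≫ g) : f = g :=
  (isColimitOfPreserves (tensorRight Y) (coproductIsCoproduct (tensorPower V))).hom_ext
    fun ⟨n⟩ => h n

lemma exists_desc (y : Y ⟶ Z) (a : V ⊗ Z ⟶ Z) : ∃ f : tensorAlg V ⊗ Y ⟶ Z,
    ∀ n, incl V n ▷ Y ≫ f = powerDesc y a n := by
  let hc := isColimitOfPreserves (tensorRight Y) (coproductIsCoproduct (tensorPower V))
  exact ⟨hc.desc ⟨_, Discrete.natTrans fun ⟨n⟩ => powerDesc y a n⟩, fun n => hc.fac _ ⟨n⟩⟩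

/-- `tensorAlg V ⊗ Y` is the free object on `Y` with an action of `V`. -/
noncomputable def desc (y : Y ⟶ Z) (a : V ⊗ Z ⟶ Z) : tensorAlg V ⊗ Y ⟶ Z :=
  (exists_desc y a).choose

lemma incl_desc (y : Y ⟶ Z) (a : V ⊗ Z ⟶ Z) (n : ℕ) :
    incl V n ▷ Y ≫ desc y a = powerDesc y a n := (exists_desc y a).choose_spec n

lemma one_desc (y : Y ⟶ Z) (a : V ⊗ Z ⟶ Z) :
    one V ▷ Y ≫ desc y a = (λ_ Y).hom ≫ y := incl_desc y a 0

lemma act_desc (y : Y ⟶ Z) (a : V ⊗ Z ⟶ Z) :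
    act V ▷ Y ≫ desc y a = (α_ V (tensorAlg V) Y).hom ≫ V ◁ desc y a ≫ a := by
  rw [← cancel_epi (α_ V (tensorAlg V) Y).inv]
  -- `V ⊗ (tensorAlg V ⊗ Y)` is the coproduct of the `V ⊗ (V^n ⊗ Y)`, and on the `n`-th summand the
  -- claim is the recursion defining `powerDesc` at `n + 1`.
  let hc := isColimitOfPreserves (tensorRight Y ⋙ tensorLeft V)
    (coproductIsCoproduct (tensorPower V))
  refine hc.hom_ext fun ⟨n⟩ => ?_
  change V ◁ (incl V n ▷ Y) ≫ _ = V ◁ (incl V n ▷ Y) ≫ _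
  have h : V ◁ (incl V n ▷ Y) ≫ V ◁ desc y a = V ◁ powerDesc y a n := by
    rw [← MonoidalCategory.whiskerLeft_comp, incl_desc]
  have h' : consIncl V n ▷ Y ≫ desc y a =
      (α_ V (tensorPower V n) Y).hom ≫ V ◁ powerDesc y a n ≫ a := incl_desc y a (n + 1)
  rw [← incl_act, comp_whiskerRight, Category.assoc] at h'
  simp only [Iso.inv_hom_id_assoc]
  rw [reassoc_of% h, associator_inv_naturality_middle_assoc, h']
  simp

/-- Each summand `V^(n+1) ⊗ Y` is reached by acting on `V^n ⊗ Y`, so an equivariant map is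
determined by induction from its restriction to `Y`. -/
lemma hom_ext {f g : tensorAlg V ⊗ Y ⟶ Z} (a : V ⊗ Z ⟶ Z)
    (h : one V ▷ Y ≫ f = one V ▷ Y ≫ g)
    (hf : act V ▷ Y ≫ f = (α_ V (tensorAlg V) Y).hom ≫ V ◁ f ≫ a)
    (hg : act V ▷ Y ≫ g = (α_ V (tensorAlg V) Y).hom ≫ V ◁ g ≫ a) : f = g := by
  refine whiskerRight_hom_ext fun n => ?_
  induction n with
  | zero => exact h
  | succ n ih =>
    have (k : tensorAlg V ⊗ Y ⟶ Z)
        (hk : act V ▷ Y ≫ k = (α_ V (tensorAlg V) Y).hom ≫ V ◁ k ≫ a) :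
        consIncl V n ▷ Y ≫ k =
          (α_ V (tensorPower V n) Y).hom ≫ V ◁ (incl V n ▷ Y ≫ k) ≫ a := by
      rw [← incl_act, comp_whiskerRight, Category.assoc, hk]
      simp
    exact (this f hf).trans (by rw [ih, ← this g hg]; rfl)

end tensorAlg

end FreeAction

end FieldTheory

namespace FieldTheory

variable {M : Type u} [Category.{v} M] [MonoidalCategory M] [SymmetricCategory M]
  [Preadditive M]

/-! ### Lie actions -/

section LieAction

variable (V : ULie M) {Z : M}

/-- The failure of `a : V ⊗ Z ⟶ Z` to be compatible with the bracket. -/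
noncomputable def bracketDefect (a : V.X ⊗ Z ⟶ Z) : (V.X ⊗ V.X) ⊗ Z ⟶ Z :=
  (α_ V.X V.X Z).hom ≫ V.X ◁ a ≫ a - (β_ V.X V.X).hom ▷ Z ≫ (α_ V.X V.X Z).hom ≫ V.X ◁ a ≫ a -
    V.bracket ▷ Z ≫ a

/-- The failure of the unit to act as the identity under `a : V ⊗ Z ⟶ Z`. -/
noncomputable def unitDefect (a : V.X ⊗ Z ⟶ Z) : Z ⟶ Z :=
  (λ_ Z).inv ≫ V.unit ▷ Z ≫ a - 𝟙 Z

/-- Actions of a unital Lie algebra: the bracket acts as the commutator and the unit as the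
identity. -/
structure IsLieAction (a : V.X ⊗ Z ⟶ Z) : Prop where
  bracket : bracketDefect V a = 0
  unit : unitDefect V a = 0

variable {V}
variable {Z' : M} {a : V.X ⊗ Z ⟶ Z} {a' : V.X ⊗ Z' ⟶ Z'} {f : Z ⟶ Z'}

/-- Defects are natural in equivariant maps. This moves relations between the tensor algebra, its
quotient and arbitrary Lie modules. -/
lemma bracketDefect_comp (h : a ≫ f = V.X ◁ f ≫ a') :
    bracketDefect V a ≫ f = (V.X ⊗ V.X) ◁ f ≫ bracketDefect V a' := by
  have h' : V.X ◁ a ≫ V.X ◁ f = V.X ◁ (V.X ◁ f) ≫ V.X ◁ a' := by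
    rw [← MonoidalCategory.whiskerLeft_comp, h, MonoidalCategory.whiskerLeft_comp]
  simp only [bracketDefect, Preadditive.sub_comp, Preadditive.comp_sub, Category.assoc, h,
    reassoc_of% h', whisker_exchange_assoc, associator_naturality_right_assoc]

lemma unitDefect_comp (h : a ≫ f = V.X ◁ f ≫ a') :
    unitDefect V a ≫ f = f ≫ unitDefect V a' := by
  simp only [unitDefect, Preadditive.sub_comp, Preadditive.comp_sub, Category.assoc, h,
    ← whisker_exchange_assoc, Category.id_comp, Category.comp_id, leftUnitor_inv_naturality_assoc]

variable [MonoidalPreadditive M]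

lemma bracketDefect_whiskerRight (a : V.X ⊗ Z ⟶ Z) (Y : M) :
    bracketDefect V ((α_ V.X Z Y).inv ≫ a ▷ Y) =
      (α_ (V.X ⊗ V.X) Z Y).inv ≫ bracketDefect V a ▷ Y := by
  have hsub {P Q : M} (f g : P ⟶ Q) : (f - g) ▷ Y = f ▷ Y - g ▷ Y := (tensorRight Y).map_sub
  simp only [bracketDefect, hsub, Preadditive.comp_sub, comp_whiskerRight, Category.assoc,
    MonoidalCategory.whiskerLeft_comp]
  simp

lemma unitDefect_whiskerRight (a : V.X ⊗ Z ⟶ Z) (Y : M) :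
    unitDefect V ((α_ V.X Z Y).inv ≫ a ▷ Y) = unitDefect V a ▷ Y := by
  have hsub {P Q : M} (f g : P ⟶ Q) : (f - g) ▷ Y = f ▷ Y - g ▷ Y := (tensorRight Y).map_sub
  simp [unitDefect, hsub]

end LieAction

/-! ### The universal enveloping algebra -/

variable [MonoidalClosed M] [HasColimits M]

/-- A morphism to the tensor algebra generates a left ideal, on which every equivariant map
vanishes that vanishes on the generators. -/
lemma tensorAlg.desc_act_whiskerRight_comp {V R Y Z : M} (r : R ⟶ tensorAlg V)
    (d : tensorAlg V ⊗ Y ⟶ Z) (a : V ⊗ Z ⟶ Z)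
    (hd : act V ▷ Y ≫ d = (α_ V (tensorAlg V) Y).hom ≫ V ◁ d ≫ a) (hr : r ▷ Y ≫ d = 0) :
    desc r (act V) ▷ Y ≫ d = 0 := by
  rw [← cancel_epi (α_ (tensorAlg V) R Y).inv, comp_zero]
  -- Up to associativity the source is free on `R ⊗ Y`, and both the given map and `0` are
  -- equivariant, so only the generators remain to be compared.
  refine hom_ext a ?_ ?_ ?_
  · have h := one_desc r (act V)
    simp only [comp_zero]
    rw [associator_inv_naturality_left_assoc, ← comp_whiskerRight_assoc, h]
    simp [hr]
  · rw [associator_inv_naturality_left_assoc, ← comp_whiskerRight_assoc, act_desc]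
    simp [hd]
  · simp

namespace Envelope

variable (V : ULie M)

/-- The two-sided ideal generated by the bracket relation, as a morphism to the tensor algebra. -/
noncomputable def bracketRel :
    tensorAlg V.X ⊗ ((V.X ⊗ V.X) ⊗ tensorAlg V.X) ⟶ tensorAlg V.X :=
  tensorAlg.desc (bracketDefect V (tensorAlg.act V.X)) (tensorAlg.act V.X)

/-- The two-sided ideal generated by the unit relation, as a morphism to the tensor algebra. -/
noncomputable def unitRel : tensorAlg V.X ⊗ tensorAlg V.X ⟶ tensorAlg V.X :=
  tensorAlg.desc (unitDefect V (tensorAlg.act V.X)) (tensorAlg.act V.X)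

instance : HasBinaryBiproducts M := HasBinaryBiproducts.of_hasBinaryCoproducts

/-- The relations of the universal enveloping algebra. -/
noncomputable def rel : (tensorAlg V.X ⊗ ((V.X ⊗ V.X) ⊗ tensorAlg V.X)) ⊞
    (tensorAlg V.X ⊗ tensorAlg V.X) ⟶ tensorAlg V.X :=
  biprod.desc (bracketRel V) (unitRel V)

/-- The underlying object of the universal enveloping algebra of a unital Lie algebra. -/
noncomputable def obj : M := cokernel (rel V)

/-- The projection from the tensor algebra. -/
noncomputable def proj : tensorAlg V.X ⟶ obj V := cokernel.π (rel V)

instance : Epi (proj V) := inferInstanceAs (Epi (cokernel.π (rel V)))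

lemma bracketRel_proj : bracketRel V ≫ proj V = 0 := by
  have h : rel V ≫ proj V = 0 := cokernel.condition _
  simpa [rel] using biprod.inl ≫= h

lemma unitRel_proj : unitRel V ≫ proj V = 0 := by
  have h : rel V ≫ proj V = 0 := cokernel.condition _
  simpa [rel] using biprod.inr ≫= h

/-- Such an `F` preserves the cokernel presenting the envelope. It is applied to `V ⊗ -` and `- ⊗
Y`. -/
lemma exists_map_proj_comp_eq (F : M ⥤ M) [F.Additive] [PreservesColimitsOfSize.{0, 0} F] {Z : M}
    (f : F.obj (tensorAlg V.X) ⟶ Z) (h₁ : F.map (bracketRel V) ≫ f = 0)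
    (h₂ : F.map (unitRel V) ≫ f = 0) : ∃ g : F.obj (obj V) ⟶ Z, F.map (proj V) ≫ g = f := by
  have h : F.map (rel V) ≫ f = 0 := by
    rw [rel, biprod.desc_eq, F.map_add, F.map_comp, F.map_comp, Preadditive.add_comp,
      Category.assoc, Category.assoc, h₁, h₂]
    simp
  refine ⟨(PreservesCokernel.iso F (rel V)).hom ≫ cokernel.desc _ f h, ?_⟩
  exact (PreservesCokernel.π_iso_hom_assoc F (rel V) _).trans (cokernel.π_desc _ _ _)

/-- Left multiplication descends because the relations are images of equivariant maps `desc r`, and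
hence stable under the action. -/
lemma exists_act : ∃ a : V.X ⊗ obj V ⟶ obj V,
    V.X ◁ proj V ≫ a = tensorAlg.act V.X ≫ proj V := by
  have h {R : M} (r : R ⟶ tensorAlg V.X)
      (hr : tensorAlg.desc r (tensorAlg.act V.X) ≫ proj V = 0) :
      V.X ◁ tensorAlg.desc r (tensorAlg.act V.X) ≫ tensorAlg.act V.X ≫ proj V = 0 := by
    rw [← cancel_epi (α_ V.X (tensorAlg V.X) R).hom]
    have := tensorAlg.act_desc r (tensorAlg.act V.X) =≫ proj V
    simp only [Category.assoc, hr] at this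
    rw [← this]
    simp
  exact exists_map_proj_comp_eq V (tensorLeft V.X) (tensorAlg.act V.X ≫ proj V)
    (h _ (bracketRel_proj V)) (h _ (unitRel_proj V))

/-- The action of `V` on its universal enveloping algebra by left multiplication. -/
noncomputable def act : V.X ⊗ obj V ⟶ obj V := (exists_act V).choose

lemma proj_act : V.X ◁ proj V ≫ act V = tensorAlg.act V.X ≫ proj V := (exists_act V).choose_spec

/-- The unit of the universal enveloping algebra. -/
noncomputable def one : 𝟙_ M ⟶ obj V := tensorAlg.one V.X ≫ proj V

instance (X : M) : Epi (X ◁ proj V) := inferInstanceAs (Epi ((tensorLeft X).map (proj V)))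

instance (X : M) : Epi (proj V ▷ X) := inferInstanceAs (Epi ((tensorRight X).map (proj V)))

/-- Restricting the relations along `one` recovers the bare defects on the tensor algebra. Thus
`proj` kills them, and since it is epi after tensoring, naturality of defects gives the vanishing on
the quotient. -/
lemma isLieAction_act : IsLieAction V (act V) where
  bracket := by
    rw [← cancel_epi ((V.X ⊗ V.X) ◁ proj V), ← bracketDefect_comp (proj_act V).symm, comp_zero]
    have h := tensorAlg.one_desc (bracketDefect V (tensorAlg.act V.X)) (tensorAlg.act V.X) =≫ proj V
    have h' := bracketRel_proj V
    rw [bracketRel] at h'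
    rw [Category.assoc, h', Category.assoc, comp_zero] at h
    rw [← cancel_epi (λ_ _).hom, ← h, comp_zero]
  unit := by
    rw [← cancel_epi (proj V), ← unitDefect_comp (proj_act V).symm, comp_zero]
    have h := tensorAlg.one_desc (unitDefect V (tensorAlg.act V.X)) (tensorAlg.act V.X) =≫ proj V
    have h' := unitRel_proj V
    rw [unitRel] at h'
    rw [Category.assoc, h', Category.assoc, comp_zero] at h
    rw [← cancel_epi (λ_ _).hom, ← h, comp_zero]

variable {V} {Y Z : M}

/-- The equivariant map `tensorAlg.desc y a` sends defects to the defects of `a`, which vanish; so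
it kills the generating relations and with them the whole ideal. -/
lemma exists_desc (y : Y ⟶ Z) {a : V.X ⊗ Z ⟶ Z} (ha : IsLieAction V a) :
    ∃ f : obj V ⊗ Y ⟶ Z, proj V ▷ Y ≫ f = tensorAlg.desc y a := by
  let a₀ := (α_ V.X (tensorAlg V.X) Y).inv ≫ tensorAlg.act V.X ▷ Y
  have h₀ : a₀ ≫ tensorAlg.desc y a = V.X ◁ tensorAlg.desc y a ≫ a := by
    simp [a₀, tensorAlg.act_desc]
  refine exists_map_proj_comp_eq V (tensorRight Y) (tensorAlg.desc y a)
    (tensorAlg.desc_act_whiskerRight_comp _ _ a (tensorAlg.act_desc y a) ?_)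
    (tensorAlg.desc_act_whiskerRight_comp _ _ a (tensorAlg.act_desc y a) ?_)
  · have h := bracketDefect_comp h₀
    rw [bracketDefect_whiskerRight, ha.bracket, comp_zero, Category.assoc] at h
    rw [← cancel_epi (α_ _ _ _).inv, h, comp_zero]
  · have h := unitDefect_comp h₀
    rwa [unitDefect_whiskerRight, ha.unit, comp_zero] at h

/-- `obj V ⊗ Y` is the free object on `Y` with a Lie action of `V`. -/
noncomputable def desc (y : Y ⟶ Z) {a : V.X ⊗ Z ⟶ Z} (ha : IsLieAction V a) : obj V ⊗ Y ⟶ Z :=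
  (exists_desc y ha).choose

lemma proj_desc (y : Y ⟶ Z) {a : V.X ⊗ Z ⟶ Z} (ha : IsLieAction V a) :
    proj V ▷ Y ≫ desc y ha = tensorAlg.desc y a := (exists_desc y ha).choose_spec

lemma one_desc (y : Y ⟶ Z) {a : V.X ⊗ Z ⟶ Z} (ha : IsLieAction V a) :
    one V ▷ Y ≫ desc y ha = (λ_ Y).hom ≫ y := by
  rw [one, comp_whiskerRight, Category.assoc, proj_desc, tensorAlg.one_desc]

lemma proj_act_whiskerRight_comp (f : obj V ⊗ Y ⟶ Z) :
    (V.X ◁ proj V) ▷ Y ≫ act V ▷ Y ≫ f = tensorAlg.act V.X ▷ Y ≫ proj V ▷ Y ≫ f := by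
  rw [← comp_whiskerRight_assoc, proj_act, comp_whiskerRight_assoc]

lemma act_desc (y : Y ⟶ Z) {a : V.X ⊗ Z ⟶ Z} (ha : IsLieAction V a) :
    act V ▷ Y ≫ desc y ha = (α_ V.X (obj V) Y).hom ≫ V.X ◁ desc y ha ≫ a := by
  have : Epi ((V.X ◁ proj V) ▷ Y) :=
    inferInstanceAs (Epi ((tensorLeft V.X ⋙ tensorRight Y).map (proj V)))
  rw [← cancel_epi ((V.X ◁ proj V) ▷ Y), proj_act_whiskerRight_comp, proj_desc,
    tensorAlg.act_desc, associator_naturality_middle_assoc,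
    ← MonoidalCategory.whiskerLeft_comp_assoc, proj_desc]

lemma hom_ext {f g : obj V ⊗ Y ⟶ Z} (a : V.X ⊗ Z ⟶ Z)
    (h : one V ▷ Y ≫ f = one V ▷ Y ≫ g)
    (hf : act V ▷ Y ≫ f = (α_ V.X (obj V) Y).hom ≫ V.X ◁ f ≫ a)
    (hg : act V ▷ Y ≫ g = (α_ V.X (obj V) Y).hom ≫ V.X ◁ g ≫ a) : f = g := by
  have key {k : obj V ⊗ Y ⟶ Z}
      (hk : act V ▷ Y ≫ k = (α_ V.X (obj V) Y).hom ≫ V.X ◁ k ≫ a) :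
      tensorAlg.act V.X ▷ Y ≫ proj V ▷ Y ≫ k =
        (α_ V.X (tensorAlg V.X) Y).hom ≫ V.X ◁ (proj V ▷ Y ≫ k) ≫ a := by
    rw [← proj_act_whiskerRight_comp, hk, associator_naturality_middle_assoc,
      ← MonoidalCategory.whiskerLeft_comp_assoc]
  rw [← cancel_epi (proj V ▷ Y)]
  refine tensorAlg.hom_ext a ?_ (key hf) (key hg)
  simpa only [one, comp_whiskerRight, Category.assoc] using h

end Envelope

end FieldTheory

namespace FieldTheory

/-! ### Products of morphisms to an algebra -/

section Products

variable {M : Type u} [Category.{v} M] [MonoidalCategory M]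

lemma tensorHom_mul_assoc {A X Y Z : M} [MonObj A] (f : X ⟶ A) (g : Y ⟶ A) (h : Z ⟶ A) :
    ((f ⊗ₘ g) ≫ MonObj.mul ⊗ₘ h) ≫ MonObj.mul =
      (α_ X Y Z).hom ≫ (f ⊗ₘ (g ⊗ₘ h) ≫ MonObj.mul) ≫ MonObj.mul := by
  have := associator_naturality_assoc f g h (A ◁ MonObj.mul ≫ MonObj.mul)
  rw [← tensorHom_comp_whiskerRight_assoc, MonObj.mul_assoc, this,
    tensorHom_comp_whiskerLeft_assoc]

variable [SymmetricCategory M] [Preadditive M] {A : Mon M}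

lemma comp_commutator_eq_zero_iff {X Y : M} (f : X ⟶ A.X) (g : Y ⟶ A.X) :
    (f ⊗ₘ g) ≫ commutator A = 0 ↔
      (f ⊗ₘ g) ≫ MonObj.mul = (β_ X Y).hom ≫ (g ⊗ₘ f) ≫ MonObj.mul := by
  rw [commutator, Preadditive.comp_sub, sub_eq_zero, BraidedCategory.braiding_naturality_assoc]

lemma comp_commutator_eq_zero_symm {X Y : M} {f : X ⟶ A.X} {g : Y ⟶ A.X}
    (h : (f ⊗ₘ g) ≫ commutator A = 0) : (g ⊗ₘ f) ≫ commutator A = 0 := by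
  rw [comp_commutator_eq_zero_iff] at h ⊢
  rw [h]
  simp

end Products

variable {M : Type u} [Category.{v} M] [MonoidalCategory M] [SymmetricCategory M]
  [MonoidalClosed M] [HasColimits M] [Preadditive M]

namespace Envelope

/-! ### The algebra structure on the envelope. -/

section Monoid

variable (V : ULie M)

/-- The multiplication of the universal enveloping algebra. -/
noncomputable def mul : obj V ⊗ obj V ⟶ obj V := desc (𝟙 _) (isLieAction_act V)

lemma one_mul : one V ▷ obj V ≫ mul V = (λ_ (obj V)).hom := by
  rw [mul, one_desc, Category.comp_id]

lemma act_mul : act V ▷ obj V ≫ mul V = (α_ V.X (obj V) (obj V)).hom ≫ V.X ◁ mul V ≫ act V :=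
  act_desc _ _

/-- `mul` is built by recursion in its left argument, so the left unit law is immediate, whereas
this law and associativity compare two maps that are equivariant in the leftmost factor. -/
lemma mul_one : obj V ◁ one V ≫ mul V = (ρ_ (obj V)).hom := by
  refine hom_ext (act V) ?_ ?_ ?_
  · rw [← whisker_exchange_assoc, one_mul]
    simp [unitors_equal]
  · rw [← whisker_exchange_assoc, act_mul]
    simp
  · simp

lemma mul_assoc :
    mul V ▷ obj V ≫ mul V = (α_ (obj V) (obj V) (obj V)).hom ≫ obj V ◁ mul V ≫ mul V := by
  rw [← cancel_epi (α_ (obj V) (obj V) (obj V)).inv, Iso.inv_hom_id_assoc]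
  refine hom_ext (act V) ?_ ?_ ?_
  · rw [associator_inv_naturality_left_assoc, ← comp_whiskerRight_assoc, one_mul,
      ← whisker_exchange_assoc, one_mul]
    simp
  · rw [associator_inv_naturality_left_assoc, ← comp_whiskerRight_assoc, act_mul]
    simp [act_mul]
  · rw [← whisker_exchange_assoc, act_mul]
    simp

/-- The universal enveloping algebra of a unital Lie algebra, whose unit is the image of the unit
of the unital Lie algebra. -/
noncomputable def mon : Mon M where
  X := obj V
  mon :=
    { one := one V
      mul := mul V
      one_mul := one_mul V
      mul_one := mul_one V
      mul_assoc := mul_assoc V }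

/-- The morphism from a unital Lie algebra to its universal enveloping algebra. -/
noncomputable def incl : V.X ⟶ obj V := (ρ_ V.X).inv ≫ V.X ◁ one V ≫ act V

lemma incl_mul : incl V ▷ obj V ≫ mul V = act V := by
  rw [incl, comp_whiskerRight, comp_whiskerRight, Category.assoc, Category.assoc, act_mul,
    associator_naturality_middle_assoc, ← MonoidalCategory.whiskerLeft_comp_assoc, one_mul]
  simp

lemma tensorHom_incl_mul : (incl V ⊗ₘ incl V) ≫ mul V = V.X ◁ incl V ≫ act V := by
  rw [tensorHom_def', Category.assoc, incl_mul]

/-- This is the unit relation evaluated at `one V`; `bracket_incl` is likewise the bracket relation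
evaluated there. -/
lemma unit_incl : V.unit ≫ incl V = one V := by
  have h := one V ≫= (isLieAction_act V).unit
  rw [unitDefect, Preadditive.comp_sub, comp_zero, sub_eq_zero, Category.comp_id] at h
  rw [incl, rightUnitor_inv_naturality_assoc, ← whisker_exchange_assoc, ← unitors_inv_equal,
    ← leftUnitor_inv_naturality_assoc, h]

lemma bracket_incl :
    V.bracket ≫ incl V = (incl V ⊗ₘ incl V) ≫ commutator (mon V) := by
  have h := (V.X ⊗ V.X) ◁ one V ≫= (isLieAction_act V).bracket
  rw [bracketDefect, comp_zero, Preadditive.comp_sub, sub_eq_zero] at h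
  have h₁ : (ρ_ (V.X ⊗ V.X)).inv ≫ (V.X ⊗ V.X) ◁ one V ≫ (α_ V.X V.X (obj V)).hom ≫
      V.X ◁ act V ≫ act V = (incl V ⊗ₘ incl V) ≫ mul V := by
    rw [tensorHom_incl_mul, incl]
    simp
  have h₂ : (β_ V.X V.X).hom ≫ (ρ_ (V.X ⊗ V.X)).inv ≫ (V.X ⊗ V.X) ◁ one V ≫
      (α_ V.X V.X (obj V)).hom ≫ V.X ◁ act V ≫ act V =
      (incl V ⊗ₘ incl V) ≫ (β_ (obj V) (obj V)).hom ≫ mul V := by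
    rw [h₁, BraidedCategory.braiding_naturality_assoc]
  refine Eq.trans ?_ (Preadditive.comp_sub (incl V ⊗ₘ incl V) (mul V)
    ((β_ (obj V) (obj V)).hom ≫ mul V)).symm
  rw [← h₁, ← h₂, incl, rightUnitor_inv_naturality_assoc, ← whisker_exchange_assoc, ← h]
  simp only [Preadditive.comp_sub]
  rw [whisker_exchange_assoc, rightUnitor_inv_naturality_assoc]

/-- The unit of the adjunction between universal enveloping algebras and commutators. -/
noncomputable def unitHom : V ⟶ (commutatorFunctor M).obj (mon V) :=
  ULie.Hom.mk (incl V) (bracket_incl V) (unit_incl V)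

end Monoid

/-! ### Extension of Lie morphisms, uniqueness and commutation. -/

section Lift

variable {V : ULie M} {A : M} [MonObj A]

lemma hom_ext_one {Z : M} {f g : obj V ⟶ Z} (a : V.X ⊗ Z ⟶ Z) (h : one V ≫ f = one V ≫ g)
    (hf : act V ≫ f = V.X ◁ f ≫ a) (hg : act V ≫ g = V.X ◁ g ≫ a) : f = g := by
  rw [← cancel_epi (ρ_ (obj V)).hom]
  refine hom_ext a ?_ ?_ ?_
  · simp [h]
  · simp [hf]
  · simp [hg]

/-- Turns multiplicativity into equivariance, with `V` acting on `A` through left multiplication, so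
that uniqueness of equivariant maps applies. -/
lemma act_comp {k : obj V ⟶ A} (hk : mul V ≫ k = (k ⊗ₘ k) ≫ MonObj.mul) :
    act V ≫ k = (incl V ≫ k ⊗ₘ k) ≫ MonObj.mul := by
  rw [← incl_mul, Category.assoc, hk, whiskerRight_comp_tensorHom_assoc]

lemma act_whiskerRight_comp_mul {k : obj V ⟶ A} {i : V.X ⟶ A}
    (hk : act V ≫ k = (i ⊗ₘ k) ≫ MonObj.mul) {Y : M} (g : Y ⟶ A) :
    act V ▷ Y ≫ (k ⊗ₘ g) ≫ MonObj.mul =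
      (α_ V.X (obj V) Y).hom ≫ V.X ◁ ((k ⊗ₘ g) ≫ MonObj.mul) ≫ i ▷ A ≫ MonObj.mul := by
  rw [whiskerRight_comp_tensorHom_assoc, hk, tensorHom_mul_assoc, ← tensorHom_def'_assoc]

variable {i : V.X ⟶ A} (hb : V.bracket ≫ i = (i ⊗ₘ i) ≫ (MonObj.mul - (β_ A A).hom ≫ MonObj.mul))
  (hu : V.unit ≫ i = MonObj.one)

include hb hu in
-- Associativity of `A` turns iterated action into action by a product, and `hb` says that the
-- bracket goes to the commutator.
lemma isLieAction_lift : IsLieAction V (i ▷ A ≫ MonObj.mul) where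
  bracket := by
    have h₁ : (α_ V.X V.X A).hom ≫ V.X ◁ (i ▷ A ≫ MonObj.mul) ≫
        i ▷ A ≫ MonObj.mul = ((i ⊗ₘ i) ≫ MonObj.mul) ▷ A ≫ MonObj.mul := by
      rw [← tensorHom_def'_assoc]
      simpa only [tensorHom_id] using (tensorHom_mul_assoc i i (𝟙 A)).symm
    have h₂ : (β_ V.X V.X).hom ≫ (i ⊗ₘ i) ≫ MonObj.mul = (i ⊗ₘ i) ≫ (β_ A A).hom ≫ MonObj.mul :=
      (BraidedCategory.braiding_naturality_assoc _ _ _).symm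
    have hsub {P Q : M} (f g : P ⟶ Q) (Y : M) : (f - g) ▷ Y = f ▷ Y - g ▷ Y :=
      (tensorRight Y).map_sub
    rw [bracketDefect, h₁, ← comp_whiskerRight_assoc, ← comp_whiskerRight_assoc, hb, h₂,
      Preadditive.comp_sub, hsub, Preadditive.sub_comp, sub_self]
  unit := by
    rw [unitDefect, ← comp_whiskerRight_assoc, hu, MonObj.one_mul]
    simp

/-- The underlying morphism of the extension of a morphism of unital Lie algebras. -/
noncomputable def liftHom : obj V ⟶ A :=
  (ρ_ (obj V)).inv ≫ desc MonObj.one (isLieAction_lift hb hu)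

lemma one_liftHom : one V ≫ liftHom hb hu = MonObj.one := by
  rw [liftHom, rightUnitor_inv_naturality_assoc, one_desc]
  simp [unitors_equal]

lemma act_liftHom : act V ≫ liftHom hb hu = (i ⊗ₘ liftHom hb hu) ≫ MonObj.mul := by
  rw [liftHom, rightUnitor_inv_naturality_assoc, act_desc, tensorHom_def']
  simp

lemma incl_liftHom : incl V ≫ liftHom hb hu = i := by
  rw [incl, Category.assoc, Category.assoc, act_liftHom, whiskerLeft_comp_tensorHom_assoc,
    one_liftHom, MonoidalCategory.tensorHom_def_assoc, MonObj.mul_one]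
  simp

lemma mul_liftHom :
    mul V ≫ liftHom hb hu = (liftHom hb hu ⊗ₘ liftHom hb hu) ≫ MonObj.mul := by
  refine hom_ext (i ▷ A ≫ MonObj.mul) ?_ ?_
    (act_whiskerRight_comp_mul (act_liftHom hb hu) (liftHom hb hu))
  · rw [← Category.assoc, one_mul, whiskerRight_comp_tensorHom_assoc, one_liftHom,
      tensorHom_def'_assoc, MonObj.one_mul]
    simp
  · rw [← Category.assoc, act_mul, Category.assoc, Category.assoc, act_liftHom,
      MonoidalCategory.whiskerLeft_comp_assoc, tensorHom_def'_assoc]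

lemma eq_of_incl_comp_eq {f g : obj V ⟶ A} (hf₁ : one V ≫ f = MonObj.one)
    (hf : mul V ≫ f = (f ⊗ₘ f) ≫ MonObj.mul) (hg₁ : one V ≫ g = MonObj.one)
    (hg : mul V ≫ g = (g ⊗ₘ g) ≫ MonObj.mul) (h : incl V ≫ f = incl V ≫ g) : f = g := by
  refine hom_ext_one ((incl V ≫ f) ▷ A ≫ MonObj.mul) (hf₁.trans hg₁.symm) ?_ ?_
  · rw [act_comp hf, tensorHom_def'_assoc]
  · rw [act_comp hg, h, tensorHom_def'_assoc]

/-- A morphism that commutes with the generators commutes with the universal enveloping algebra. -/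
lemma commute {k : obj V ⟶ A} (hk₁ : one V ≫ k = MonObj.one)
    (hk : mul V ≫ k = (k ⊗ₘ k) ≫ MonObj.mul) {Y : M} (g : Y ⟶ A)
    (h : (incl V ≫ k ⊗ₘ g) ≫ MonObj.mul = (β_ V.X Y).hom ≫ (g ⊗ₘ incl V ≫ k) ≫ MonObj.mul) :
    (k ⊗ₘ g) ≫ MonObj.mul = (β_ (obj V) Y).hom ≫ (g ⊗ₘ k) ≫ MonObj.mul := by
  have hact := act_comp hk
  generalize incl V ≫ k = i at h hact
  refine hom_ext (i ▷ A ≫ MonObj.mul) ?_ (act_whiskerRight_comp_mul hact g) ?_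
  · rw [BraidedCategory.braiding_naturality_left_assoc, whiskerRight_comp_tensorHom_assoc,
      whiskerLeft_comp_tensorHom_assoc, hk₁, tensorHom_def'_assoc, MonObj.one_mul,
      MonoidalCategory.tensorHom_def_assoc, MonObj.mul_one]
    simp
  -- In elements, `g(y) (i(x) k(u)) = i(x) (g(y) k(u))` by `h` and associativity. This makes the
  -- opposite product equivariant too.
  · have h' : ((β_ V.X Y).hom ▷ obj V) ≫ (α_ Y V.X (obj V)).hom ≫
        (g ⊗ₘ (i ⊗ₘ k) ≫ MonObj.mul) ≫ MonObj.mul =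
        (α_ V.X Y (obj V)).hom ≫ (i ⊗ₘ (g ⊗ₘ k) ≫ MonObj.mul) ≫ MonObj.mul := by
      rw [← tensorHom_mul_assoc, ← tensorHom_mul_assoc, whiskerRight_comp_tensorHom_assoc, h]
    rw [BraidedCategory.braiding_naturality_left_assoc, whiskerLeft_comp_tensorHom_assoc, hact,
      BraidedCategory.braiding_tensor_left_hom]
    simp only [Category.assoc]
    rw [h', Iso.inv_hom_id_assoc, whiskerLeft_comp_tensorHom_assoc, ← tensorHom_def'_assoc]

end Lift

section Universal

variable {V : ULie M} {A : Mon M}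

/-- The morphism of algebras which extends a morphism of unital Lie algebras. -/
noncomputable def lift (g : V ⟶ (commutatorFunctor M).obj A) : mon V ⟶ A :=
  Mon.Hom.mk' (M := mon V) (N := A) (liftHom (A := A.X) g.bracket_hom g.unit_hom)
    (one_liftHom (A := A.X) _ _) (mul_liftHom (A := A.X) _ _)

lemma mul_hom (k : mon V ⟶ A) :
    mul V ≫ (show obj V ⟶ A.X from k.hom) = (k.hom ⊗ₘ k.hom) ≫ MonObj.mul :=
  IsMonHom.mul_hom k.hom

lemma one_hom (k : mon V ⟶ A) :
    one V ≫ (show obj V ⟶ A.X from k.hom) = MonObj.one := IsMonHom.one_hom k.hom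

lemma mon_hom_ext {f f' : mon V ⟶ A} (h : incl V ≫ f.hom = incl V ≫ f'.hom) : f = f' :=
  Mon.Hom.ext (eq_of_incl_comp_eq (one_hom f) (mul_hom f) (one_hom f') (mul_hom f') h)

/-- The universal property of the universal enveloping algebra. -/
noncomputable def homEquiv (V : ULie M) (A : Mon M) :
    (mon V ⟶ A) ≃ (V ⟶ (commutatorFunctor M).obj A) where
  toFun f := unitHom V ≫ (commutatorFunctor M).map f
  invFun := lift
  left_inv f := mon_hom_ext (incl_liftHom (A := A.X)
    (unitHom V ≫ (commutatorFunctor M).map f).bracket_hom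
    (unitHom V ≫ (commutatorFunctor M).map f).unit_hom)
  right_inv g := ULie.Hom.ext (incl_liftHom (A := A.X) g.bracket_hom g.unit_hom)

end Universal

end Envelope

variable (M) in
/-- The universal enveloping algebra functor. -/
noncomputable def envelope : ULie M ⥤ Mon M :=
  Adjunction.leftAdjointOfEquiv (G := commutatorFunctor M) Envelope.homEquiv
    (fun _ _ _ _ _ => by simp [Envelope.homEquiv])

variable (M) in
/-- The universal enveloping algebra functor is left adjoint to the commutator functor. -/
noncomputable def envelopeAdjunction : envelope M ⊣ commutatorFunctor M :=
  Adjunction.adjunctionOfEquivLeft _ _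

lemma incl_envelope_map {V W : ULie M} (f : V ⟶ W) :
    Envelope.incl V ≫ ((envelope M).map f).hom = f.hom ≫ Envelope.incl W := by
  have h : (Envelope.homEquiv V (Envelope.mon W)) ((envelope M).map f) =
      f ≫ Envelope.homEquiv W (Envelope.mon W) (𝟙 _) := Equiv.apply_symm_apply _ _
  have h' := congrArg ULie.Hom.hom h
  simp only [Envelope.homEquiv, Equiv.coe_fn_mk, CategoryTheory.Functor.map_id,
    Category.comp_id] at h'
  exact h'

/-! ### Commutation of images of envelopes. -/

section Commuting

variable {A : Mon M}

/-- `commute` enlarges one argument from generators to the envelope; it is used once for each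
argument, with the symmetry of commutation in between. -/
lemma Envelope.comp_commutator_eq_zero {V W : ULie M} (f : mon V ⟶ A) (g : mon W ⟶ A)
    (h : ((incl V ≫ f.hom) ⊗ₘ (incl W ≫ g.hom)) ≫ commutator A = 0) :
    (f.hom ⊗ₘ g.hom) ≫ commutator A = 0 := by
  have h₁ : (f.hom ⊗ₘ (incl W ≫ g.hom)) ≫ commutator A = 0 :=
    (comp_commutator_eq_zero_iff f.hom _).2
      (commute (one_hom f) (mul_hom f) _ ((comp_commutator_eq_zero_iff _ _).1 h))
  exact comp_commutator_eq_zero_symm ((comp_commutator_eq_zero_iff g.hom f.hom).2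
    (commute (one_hom g) (mul_hom g) _
      ((comp_commutator_eq_zero_iff _ _).1 (comp_commutator_eq_zero_symm h₁))))

lemma Envelope.tensorHom_incl_comp_commutator_eq_zero {V : ULie M} {X Y : M} {f : X ⟶ V.X}
    {g : Y ⟶ V.X} (h : (f ⊗ₘ g) ≫ V.bracket = 0) :
    ((f ≫ incl V) ⊗ₘ (g ≫ incl V)) ≫ commutator (mon V) = 0 := by
  refine (tensorHom_comp_tensorHom_assoc f g (incl V) (incl V) _).symm.trans
    ((congrArg ((f ⊗ₘ g) ≫ ·) (bracket_incl V).symm).trans ?_)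
  change (f ⊗ₘ g) ≫ V.bracket ≫ incl V = 0
  rw [← Category.assoc, h, zero_comp]

end Commuting

end FieldTheory

namespace FieldTheory

section Invariance

variable {M : Type u} [Category.{v} M] [MonoidalCategory M] [SymmetricCategory M] [Preadditive M]
variable {C : Type v} [SmallCategory C] {perp : OrthogonalityRelation C}

lemma QFT.IsWConstant.of_iso {W : MorphismProperty C} {A B : QFT M perp} (e : A ≅ B)
    (hA : QFT.IsWConstant W A) : QFT.IsWConstant W B := fun _ _ f hf =>
  ((MorphismProperty.isomorphisms _).arrow_mk_iso_iff
    (Arrow.isoOfNatIso ((IsQFT M perp).ι.mapIso e) (Arrow.mk f))).1 (hA f hf)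

end Invariance

/-! ### Linear quantization and the preservation of locality and constancy. -/

section Quantization

variable (M : Type u) [Category.{v} M] [MonoidalCategory M] [SymmetricCategory M]
  [MonoidalClosed M] [HasColimits M] [Preadditive M]
variable {C : Type v} [SmallCategory C] (perp : OrthogonalityRelation C)

lemma isQFT_comp_envelope (L : LFT M perp) : IsQFT M perp (L.obj ⋙ envelope M) := by
  intro c₁ c₂ c f₁ f₂ h
  refine Envelope.comp_commutator_eq_zero ((envelope M).map (L.obj.map f₁))
    ((envelope M).map (L.obj.map f₂)) ?_
  rw [incl_envelope_map, incl_envelope_map]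
  exact Envelope.tensorHom_incl_comp_commutator_eq_zero (L.property f₁ f₂ h)

/-- The linear quantization functor, which applies the universal enveloping algebra functor
objectwise. -/
noncomputable def quantization : LFT M perp ⥤ QFT M perp :=
  (IsQFT M perp).lift
    ((IsLFT M perp).ι ⋙ (Functor.whiskeringRight C _ _).obj (envelope M))
    (isQFT_comp_envelope M perp)

/-- Linear quantization is left adjoint to `Ulin`. -/
noncomputable def quantizationAdjunction : quantization M perp ⊣ Ulin M perp :=
  (Adjunction.whiskerRight C (envelopeAdjunction M)).restrictFullyFaithful
    (IsLFT M perp).fullyFaithfulι (IsQFT M perp).fullyFaithfulι (Iso.refl _) (Iso.refl _)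

variable {M perp}

/-- Transposition is computed at each object of `C`, and therefore commutes with restriction to a
full subcategory. -/
lemma quantizationAdjunction_homEquiv_app (L : LFT M perp) (A : QFT M perp)
    (g : (quantization M perp).obj L ⟶ A) (c : C) :
    ((quantizationAdjunction M perp).homEquiv L A g).hom.app c =
      (envelopeAdjunction M).homEquiv (L.obj.obj c) (A.obj.obj c) (g.hom.app c) := by
  refine (congrArg (fun k => k.hom.app c) (Adjunction.restrictFullyFaithful_homEquiv_apply
    (L := quantization M perp) (R := Ulin M perp)
    (Adjunction.whiskerRight C (envelopeAdjunction M)) (IsLFT M perp).fullyFaithfulι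
    (IsQFT M perp).fullyFaithfulι (Iso.refl _) (Iso.refl _) g)).trans ?_
  have h {X : ULie M} {Y : Mon M} (k : (envelope M).obj X ⟶ Y) :
      (envelopeAdjunction M).unit.app X ≫ (commutatorFunctor M).map (𝟙 ((envelope M).obj X)) ≫
        (commutatorFunctor M).map k ≫ 𝟙 _ = (envelopeAdjunction M).homEquiv X Y k := by
    simp [Adjunction.homEquiv_unit]
  change ((Adjunction.whiskerRight C (envelopeAdjunction M)).unit.app L.obj).app c ≫
    (commutatorFunctor M).map (𝟙 _) ≫ (commutatorFunctor M).map (g.hom.app c) ≫ 𝟙 _ = _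
  rw [Adjunction.whiskerRight_unit_app_app]
  exact h (g.hom.app c)

lemma quantization_isJLocal (P : ObjectProperty C) (L : LFT M perp) (hL : LFT.IsJLocal P L) :
    QFT.IsJLocal P ((quantization M perp).obj L) := by
  refine (isIsoCounit_iff_bijective_map _ _).2 fun A => ?_
  have hb := (isIsoCounit_iff_bijective_map _ _).1 hL ((Ulin M perp).obj A)
  -- The adjunction over the subcategory applies because `j^*` commutes definitionally with
  -- `quantization` and with `Ulin`.
  let eB : ((QFT.restrict M perp P).obj ((quantization M perp).obj L) ⟶
      (QFT.restrict M perp P).obj A) ≃ ((LFT.restrict M perp P).obj L ⟶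
      (LFT.restrict M perp P).obj ((Ulin M perp).obj A)) :=
    (quantizationAdjunction M (perp.restrict P)).homEquiv
      ((LFT.restrict M perp P).obj L) ((QFT.restrict M perp P).obj A)
  refine (Function.Bijective.of_comp_iff' eB.bijective _).1 ?_
  -- What remains is the commuting square: restricting and then transposing equals transposing and
  -- then restricting.
  convert hb.comp ((quantizationAdjunction M perp).homEquiv L A).bijective using 1
  funext g
  apply ObjectProperty.hom_ext
  ext c
  exact (quantizationAdjunction_homEquiv_app (L := (LFT.restrict M perp P).obj L)
    (A := (QFT.restrict M perp P).obj A) _ c).trans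
      (quantizationAdjunction_homEquiv_app L A g c.obj).symm

lemma quantization_isWConstant (W : MorphismProperty C) (L : LFT M perp)
    (hL : LFT.IsWConstant W L) : QFT.IsWConstant W ((quantization M perp).obj L) := by
  intro c c' f hf
  have := hL f hf
  exact inferInstanceAs (IsIso ((envelope M).map (L.obj.map f)))

end Quantization

end FieldTheory

theorem corollary5p4 {M : Type u} [Category.{v} M] [MonoidalCategory M] [SymmetricCategory M]
    [MonoidalClosed M] [HasLimits M] [HasColimits M] [Preadditive M]
    {C : Type v} [SmallCategory C] (perp : FieldTheory.OrthogonalityRelation C) :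
    (FieldTheory.Ulin M perp).IsRightAdjoint ∧
    ∀ (Qlin : FieldTheory.LFT M perp ⥤ FieldTheory.QFT M perp)
      (_ : Qlin ⊣ FieldTheory.Ulin M perp),
      (∀ (P : ObjectProperty C) (L : FieldTheory.LFT M perp),
        FieldTheory.LFT.IsJLocal P L → FieldTheory.QFT.IsJLocal P (Qlin.obj L)) ∧
      (∀ (W : MorphismProperty C) (L : FieldTheory.LFT M perp),
        FieldTheory.LFT.IsWConstant W L → FieldTheory.QFT.IsWConstant W (Qlin.obj L)) := by
  refine ⟨(FieldTheory.quantizationAdjunction M perp).isRightAdjoint, fun Qlin adj => ?_⟩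
  -- Any left adjoint is isomorphic to the objectwise envelope, and both properties are invariant
  -- under isomorphism.
  have e := (FieldTheory.quantizationAdjunction M perp).leftAdjointUniq adj
  exact ⟨fun P L hL => (FieldTheory.quantization_isJLocal P L hL).of_iso (e.app L),
    fun W L hL => (FieldTheory.quantization_isWConstant W L hL).of_iso (e.app L)⟩
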